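/- Let $R$ be a commutative noetherian ring. For an $R$-module $X$ write $X^*=\mathrm{Hom}_R(X,R)$. For an $R$-algebra $A$ let $A^\circ=\{f\in A^*\mid AfA\text{ is finitely generated over }R\}$, where $(af)(b)=f(ba)$ and $(fa)(b)=f(ab)$. Assume that $A$ is an $\alpha$-algebra, i.e. $A^\circ\subseteq R^A$ is a pure $R$-submodule (tensoring the inclusion with any $R$-module keeps it injective). Let $C$ be an $R$-coalgebra; $C^*$ is an $R$-algebra under convolution. Let $(A,C,\psi)$ be a right-right entwining structure, i.e. $\psi:C\otimes_RA\to A\otimes_RC$, $c\otimes a\mapsto\sum a_\psi\otimes c^\psi$, is $R$-linear with $$\sum(ab)_\psi\otimes c^\psi=\sum a_\psi b_\Psi\otimes c^{\psi\Psi},\quad \sum 1_\psi\otimes c^\psi=1\otimes c,\quad \sum a_\psi\otimes\Delta(c^\psi)=\sum a_{\psi\Psi}\otimes c_1^\Psi\otimes c_2^\psi,\quad \sum\varepsilon(c^\psi)a_\psi=\varepsilon(c)a .$$ Its entwined modules are the right $A$-modules $M$ that are right $C$-comodules with $\varrho_M(ma)=\sum m_{<0>}a_\psi\otimes m_{<1>}^\psi$;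 together with the $A$-linear $C$-colinear maps they form the category $\mathcal M_A^C(\psi)$, with morphism sets $\mathrm{Hom}_A^C$. Let $\widetilde A\subseteq C^*$ be an $R$-subalgebra (with unit $\varepsilon_C$), and let $\widetilde C\subseteq A^\circ$ be an $R$-subcoalgebra, i.e. a pure $R$-submodule with $\Delta(\widetilde C)\subseteq\widetilde C\otimes_R\widetilde C$, where $\Delta(f)$ corresponds to the functional $a\otimes b\mapsto f(ab)$ and $\varepsilon(f)=f(1)$. Assume that $\psi^*:(A\otimes_RC)^*\to(C\otimes_RA)^*$ restricts, along the canonical maps, to an $R$-linear map $\varphi:\widetilde C\otimes_R\widetilde A\to\widetilde A\otimes_R\widetilde C$. For a measuring pairing $(B,D)$, i.e. an $R$-algebra $B$, an $R$-coalgebra $D$ and an algebra morphism $B\to D^*$, $b\mapsto\langle b,-\rangle$, and an $R$-module $N$ let $\alpha_N:N\otimes_RD\to\mathrm{Hom}_R(B,N)$, $n\otimes d\mapsto[b\mapsto\langle b,d\rangle n]$. The pairing satisfies the $\alpha$-condition if $\alpha_N$ is injective for every $R$-module $N$. In that case, for a left $B$-module $N$, put $\mathrm{Rat}^D({}_BN)=\{n\in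 N\mid[b\mapsto bn]\in\alpha_N(N\otimes_RD)\}$, a right $D$-comodule through $n\mapsto\alpha^{-1}([b\mapsto bn])$. The pairing $(A,\widetilde C)$ always satisfies the $\alpha$-condition. Suppose that the pairing $(\widetilde A,C)$ satisfies the $\alpha$-condition. Then $(\widetilde A,\widetilde C,\varphi)$ is a right-right entwining structure, and $$M\mapsto M_r=\mathrm{Rat}^{\widetilde C}({}_AM^*),\qquad K\mapsto K^r=\mathrm{Rat}^{C}({}_{\widetilde A}K^*),$$ with $f\mapsto f^*$ on morphisms, are contravariant functors $\mathcal M_A^C(\psi)\to\mathcal M_{\widetilde A}^{\widetilde C}(\varphi)$ and $\mathcal M_{\widetilde A}^{\widetilde C}(\varphi)\to\mathcal M_A^C(\psi)$. Here $(ah)(m)=h(ma)$ and $(h\widetilde g)(m)=\sum h(m_{<0>})\,\widetilde g(m_{<1>})$ for $h\in M^*$, and $(\widetilde gf)(k)=f(k\widetilde g)$ and $(fa)(k)=\sum f(k_{<0>})\,k_{<1>}(a)$ for $f\in K^*$. These functors are right adjoint to each other: there are bijections $$\mathrm{Hom}_A^C(M,K^r)\cong\mathrm{Hom}_{\widetilde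 A}^{\widetilde C}(K,M_r),$$ natural in $M$ and $K$, under which $f$ and $g$ correspond if and only if $f(m)(k)=g(k)(m)$ for all $m\in M$, $k\in K$. -/

import Mathlib

universe u

open TensorProduct CategoryTheory MulOpposite

noncomputable section

namespace Entwined

section Pairings

variable {R A C : Type u} [CommRing R] [Semiring A] [Algebra R A]
  [AddCommMonoid C] [Module R C] [Coalgebra R C]
variable {M N : Type u} [AddCommMonoid M] [Module R M] [AddCommMonoid N] [Module R N]

/-- A measuring `R`-pairing `(A, C)`: an `R`-algebra morphism `κ : A → C*`, where `C*` carries the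
convolution product. -/
abbrev MeasuringPairing (R A C : Type u) [CommRing R] [Semiring A] [Algebra R A]
    [AddCommMonoid C] [Module R C] [Coalgebra R C] : Type u :=
  A →ₐ[R] WithConv (C →ₗ[R] R)

/-- The bilinear form `⟨a, c⟩ = κ(a)(c)` of a measuring pairing. -/
def form (κ : MeasuringPairing R A C) : A →ₗ[R] C →ₗ[R] R :=
  (WithConv.linearEquiv R (C →ₗ[R] R)).toLinearMap ∘ₗ κ.toLinearMap

/-- The map `α_M : M ⊗ C → Hom_R(A, M)`, `m ⊗ c ↦ [a ↦ ⟨a, c⟩ m]`. -/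
def alpha (κ : MeasuringPairing R A C) (M : Type u) [AddCommMonoid M] [Module R M] :
    M ⊗[R] C →ₗ[R] A →ₗ[R] M :=
  TensorProduct.lift <| LinearMap.mk₂ R
    (fun m c => LinearMap.toSpanSingleton R M m ∘ₗ (form κ).flip c)
    (fun m m' c => by ext; simp) (fun r m c => by ext a; exact smul_comm _ _ _)
    (fun m c c' => by ext; simp [add_smul]) (fun r m c => by ext; simp [mul_smul])

@[simp]
theorem alpha_tmul (κ : MeasuringPairing R A C) (m : M) (c : C) (a : A) :
    alpha κ M (m ⊗ₜ[R] c) a = form κ a c • m := rfl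

/-- The `α`-condition for a measuring pairing. (As `R` is a ring, an `R`-module structure on an
additive commutative monoid makes it a group, so `M` ranges over all `R`-modules; likewise a
semiring with an `R`-algebra structure is a ring.) -/
def AlphaCondition (κ : MeasuringPairing R A C) : Prop :=
  ∀ (M : Type u) [AddCommMonoid M] [Module R M], Function.Injective (alpha κ M)

/-- The rational part `Rat^C(_A N) = ρ_N⁻¹(N ⊗ C)` of a left `A`-module `N`. The module structure is
given as the algebra morphism `A → End_R(N)`; the map `ρ_N : N → Hom_R(A, N)` sends `n` to
`[a ↦ a n]`, and `N ⊗ C` is viewed inside `Hom_R(A, N)` through `α_N`. -/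
def rat (κ : MeasuringPairing R A C) (act : A →ₐ[R] Module.End R N) : Submodule R N :=
  (LinearMap.range (alpha κ N)).comap act.toLinearMap.flip

theorem mem_rat {κ : MeasuringPairing R A C} {act : A →ₐ[R] Module.End R N} {n : N} :
    n ∈ rat κ act ↔ ∃ t : N ⊗[R] C, ∀ a, alpha κ N t a = act a n := by
  simp only [rat, Submodule.mem_comap, LinearMap.mem_range, LinearMap.ext_iff]
  rfl

theorem alpha_natural (κ : MeasuringPairing R A C) (f : M →ₗ[R] N) (t : M ⊗[R] C) (a : A) :
    alpha κ N (f.rTensor C t) a = f (alpha κ M t a) := by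
  induction t with
  | zero => simp
  | tmul m c => simp
  | add x y hx hy => simp [hx, hy]

theorem form_one (κ : MeasuringPairing R A C) (c : C) :
    form κ 1 c = Coalgebra.counit (R := R) c := by
  simp [form]

theorem form_mul (κ : MeasuringPairing R A C) (a b : A) (c : C) :
    form κ (a * b) c =
      LinearMap.mul' R R (TensorProduct.map (form κ a) (form κ b) (Coalgebra.comul c)) := by
  simp [form]

theorem alpha_one (κ : MeasuringPairing R A C) (t : M ⊗[R] C) :
    alpha κ M t 1 = TensorProduct.rid R M ((Coalgebra.counit (R := R)).lTensor M t) := by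
  induction t with
  | zero => simp
  | tmul m c => simp [form_one]
  | add x y hx hy => simp [hx, hy]

theorem alpha_mul (κ : MeasuringPairing R A C) (t : M ⊗[R] C) (a b : A) :
    alpha κ M t (a * b) = alpha κ M (alpha κ (M ⊗[R] C)
      ((TensorProduct.assoc R M C C).symm ((Coalgebra.comul (R := R)).lTensor M t)) b) a := by
  induction t with
  | zero => simp
  | tmul m c =>
    simp only [alpha_tmul, form_mul, LinearMap.lTensor_tmul]
    generalize (Coalgebra.comul (R := R) c) = w
    induction w with
    | zero => simp
    | tmul x y => simp [smul_smul, mul_comm]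
    | add x y hx hy => simp [tmul_add, add_smul, hx, hy]
  | add x y hx hy => simp [hx, hy]

end Pairings

section Rational

variable {R A C : Type u} [CommRing R] [Semiring A] [Algebra R A]
  [AddCommMonoid C] [Module R C] [Coalgebra R C]
variable {M N : Type u} [AddCommMonoid M] [Module R M] [AddCommMonoid N] [Module R N]

theorem rat_act_mem {κ : MeasuringPairing R A C} {act : A →ₐ[R] Module.End R N} {n : N}
    (hn : n ∈ rat κ act) (a : A) : act a n ∈ rat κ act := by
  obtain ⟨t, ht⟩ := mem_rat.1 hn
  refine mem_rat.2 ⟨alpha κ (N ⊗[R] C)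
      ((TensorProduct.assoc R N C C).symm ((Coalgebra.comul (R := R)).lTensor N t)) a, fun b => ?_⟩
  rw [← alpha_mul, ht, map_mul, Module.End.mul_apply]

/-- The restriction `ρ : Rat → Hom_R(A, Rat)` of `ρ_N`. -/
def ratRho (κ : MeasuringPairing R A C) (act : A →ₐ[R] Module.End R N) :
    rat κ act →ₗ[R] A →ₗ[R] rat κ act :=
  LinearMap.mk₂ R (fun n a => ⟨act a n, rat_act_mem n.2 a⟩)
    (fun _ _ _ => by ext; simp) (fun _ _ _ => by ext; simp)
    (fun _ _ _ => by ext; simp) (fun _ _ _ => by ext; simp)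

@[simp]
theorem coe_ratRho (κ : MeasuringPairing R A C) (act : A →ₐ[R] Module.End R N)
    (n : rat κ act) (a : A) : (ratRho κ act n a : N) = act a n := rfl

theorem exists_rTensor_subtype_eq {N C : Type u} [AddCommGroup N] [Module R N] [AddCommGroup C]
    [Module R C] (S : Submodule R N) (t : N ⊗[R] C) (h : S.mkQ.rTensor C t = 0) :
    ∃ s, S.subtype.rTensor C s = t :=
  (rTensor_exact C (f := S.subtype) (g := S.mkQ) (LinearMap.exact_subtype_mkQ _)
    (Submodule.mkQ_surjective _) t).1 h

theorem exists_rTensor_subtype_eq' (κ : MeasuringPairing R A C) (hκ : AlphaCondition κ)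
    (S : Submodule R N) (t : N ⊗[R] C) (h : ∀ a, alpha κ N t a ∈ S) :
    ∃ s, S.subtype.rTensor C s = t := by
  let _ : AddCommGroup N := Module.addCommMonoidToAddCommGroup R
  let _ : AddCommGroup C := Module.addCommMonoidToAddCommGroup R
  refine exists_rTensor_subtype_eq S t (hκ (N ⧸ S) (LinearMap.ext fun a => ?_))
  have h1 := alpha_natural κ S.mkQ t a
  have h2 : S.mkQ (alpha κ N t a) = 0 := by simpa using h a
  rw [h2] at h1
  rw [map_zero]
  exact h1

theorem ratRho_mem_range {κ : MeasuringPairing R A C} (hκ : AlphaCondition κ)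
    (act : A →ₐ[R] Module.End R N) (n : rat κ act) :
    ratRho κ act n ∈ LinearMap.range (alpha κ (rat κ act)) := by
  obtain ⟨t, ht⟩ := mem_rat.1 n.2
  obtain ⟨s, hs⟩ := exists_rTensor_subtype_eq' κ hκ (rat κ act) t
    fun a => by rw [ht]; exact rat_act_mem n.2 a
  refine ⟨s, ?_⟩
  ext a
  rw [coe_ratRho, ← ht, ← hs, alpha_natural]
  rfl

/-- The coaction `ϱ = α⁻¹ ∘ ρ : Rat → Rat ⊗ C` of a measuring `α`-pairing. -/
def ratCoact {κ : MeasuringPairing R A C} (hκ : AlphaCondition κ)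
    (act : A →ₐ[R] Module.End R N) : rat κ act →ₗ[R] rat κ act ⊗[R] C :=
  (LinearEquiv.ofInjective (alpha κ (rat κ act)) (hκ _)).symm.toLinearMap ∘ₗ
    (ratRho κ act).codRestrict _ (ratRho_mem_range hκ act)

@[simp]
theorem alpha_ratCoact {κ : MeasuringPairing R A C} (hκ : AlphaCondition κ)
    (act : A →ₐ[R] Module.End R N) (n : rat κ act) :
    alpha κ _ (ratCoact hκ act n) = ratRho κ act n :=
  congrArg Subtype.val ((LinearEquiv.ofInjective (alpha κ (rat κ act)) (hκ _)).apply_symm_apply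
    ((ratRho κ act).codRestrict _ (ratRho_mem_range hκ act) n))

theorem ratCoact_coassoc {κ : MeasuringPairing R A C} (hκ : AlphaCondition κ)
    (act : A →ₐ[R] Module.End R N) (n : rat κ act) :
    TensorProduct.assoc R _ _ _ ((ratCoact hκ act).rTensor C (ratCoact hκ act n)) =
      (Coalgebra.comul (R := R)).lTensor _ (ratCoact hκ act n) := by
  apply (TensorProduct.assoc R (rat κ act) C C).symm.injective
  rw [LinearEquiv.symm_apply_apply]
  refine hκ (rat κ act ⊗[R] C) (LinearMap.ext fun b => hκ (rat κ act) (LinearMap.ext fun a => ?_))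
  rw [alpha_natural, ← alpha_mul, alpha_ratCoact, alpha_ratCoact]
  exact Subtype.ext (by simp)

theorem ratCoact_counit {κ : MeasuringPairing R A C} (hκ : AlphaCondition κ)
    (act : A →ₐ[R] Module.End R N) (n : rat κ act) :
    TensorProduct.rid R _ ((Coalgebra.counit (R := R)).lTensor _ (ratCoact hκ act n)) = n := by
  rw [← alpha_one κ, alpha_ratCoact]
  exact Subtype.ext (by simp)

end Rational

section EntwiningStructures

variable {R A C : Type u} [CommRing R] [Semiring A] [Algebra R A] [AddCommMonoid C] [Module R C]

/-- For `ψ : C ⊗ A → A ⊗ C` and `a ∈ A`, the map `c ↦ ψ(c ⊗ a) = ∑ a_ψ ⊗ c^ψ`. -/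
def slice (ψ : C ⊗[R] A →ₗ[R] A ⊗[R] C) (a : A) : C →ₗ[R] A ⊗[R] C :=
  ψ ∘ₗ (TensorProduct.mk R C A).flip a

@[simp]
theorem slice_apply (ψ : C ⊗[R] A →ₗ[R] A ⊗[R] C) (a : A) (c : C) :
    slice ψ a c = ψ (c ⊗ₜ[R] a) := rfl

variable [Coalgebra R C]

/-- `(A, C, ψ)` is a right-right entwining structure. -/
structure IsEntwining (ψ : C ⊗[R] A →ₗ[R] A ⊗[R] C) : Prop where
  /-- `∑ (ab)_ψ ⊗ c^ψ = ∑ a_ψ b_Ψ ⊗ c^{ψΨ}` -/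
  map_mul : ∀ (c : C) (a b : A), ψ (c ⊗ₜ[R] (a * b)) =
    (LinearMap.mul' R A).rTensor C ((TensorProduct.assoc R A A C).symm
      ((slice ψ b).lTensor A (ψ (c ⊗ₜ[R] a))))
  /-- `∑ 1_ψ ⊗ c^ψ = 1 ⊗ c` -/
  map_one : ∀ c : C, ψ (c ⊗ₜ[R] 1) = 1 ⊗ₜ[R] c
  /-- `∑ a_ψ ⊗ Δ(c^ψ) = ∑ a_{ψΨ} ⊗ c₁^Ψ ⊗ c₂^ψ` -/
  map_comul : ∀ (c : C) (a : A),
    (Coalgebra.comul (R := R)).lTensor A (ψ (c ⊗ₜ[R] a)) =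
      TensorProduct.assoc R A C C (ψ.rTensor C ((TensorProduct.assoc R C A C).symm
        ((slice ψ a).lTensor C (Coalgebra.comul (R := R) c))))
  /-- `∑ ε(c^ψ) a_ψ = ε(c) a` -/
  map_counit : ∀ (c : C) (a : A),
    TensorProduct.rid R A ((Coalgebra.counit (R := R)).lTensor A (ψ (c ⊗ₜ[R] a))) =
      Coalgebra.counit (R := R) c • a

/-- The map `M ⊗ A → M`, `m ⊗ a ↦ m a` of a right `A`-module `M`, the latter being given as the
algebra morphism `Aᵐᵒᵖ → End_R(M)`. -/
def rightMul {M : Type u} [AddCommMonoid M] [Module R M] (act : Aᵐᵒᵖ →ₐ[R] Module.End R M) :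
    M ⊗[R] A →ₗ[R] M :=
  TensorProduct.lift (act.toLinearMap ∘ₗ (opLinearEquiv R).toLinearMap).flip

@[simp]
theorem rightMul_tmul {M : Type u} [AddCommMonoid M] [Module R M]
    (act : Aᵐᵒᵖ →ₐ[R] Module.End R M) (m : M) (a : A) :
    rightMul act (m ⊗ₜ[R] a) = act (op a) m := rfl

/-- The map `M ⊗ C → M ⊗ C`, `m ⊗ c ↦ ∑ m a_ψ ⊗ c^ψ`. -/
def entwine (ψ : C ⊗[R] A →ₗ[R] A ⊗[R] C) {M : Type u} [AddCommMonoid M] [Module R M]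
    (act : Aᵐᵒᵖ →ₐ[R] Module.End R M) (a : A) : M ⊗[R] C →ₗ[R] M ⊗[R] C :=
  (rightMul act).rTensor C ∘ₗ (TensorProduct.assoc R M A C).symm.toLinearMap ∘ₗ
    (slice ψ a).lTensor M

/-- A (right-right) entwined module over `(A, C, ψ)`: a right `A`-module (an algebra morphism
`Aᵐᵒᵖ → End_R(M)`) that is a right `C`-comodule, with `ϱ(m a) = ∑ m₀ a_ψ ⊗ m₁^ψ`. -/
structure EntwinedModule (ψ : C ⊗[R] A →ₗ[R] A ⊗[R] C) where
  carrier : Type u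
  [addCommMonoid : AddCommMonoid carrier]
  [module : Module R carrier]
  act : Aᵐᵒᵖ →ₐ[R] Module.End R carrier
  coact : carrier →ₗ[R] carrier ⊗[R] C
  coassoc : ∀ m, TensorProduct.assoc R carrier C C (coact.rTensor C (coact m)) =
    (Coalgebra.comul (R := R)).lTensor carrier (coact m)
  counit : ∀ m,
    TensorProduct.rid R carrier ((Coalgebra.counit (R := R)).lTensor carrier (coact m)) = m
  coact_act : ∀ m a, coact (act (op a) m) = entwine ψ act a (coact m)

attribute [instance] EntwinedModule.addCommMonoid EntwinedModule.module

variable {ψ : C ⊗[R] A →ₗ[R] A ⊗[R] C}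

/-- `A`-linear `C`-colinear maps. -/
@[ext]
structure EntwinedModule.Hom (M N : EntwinedModule ψ) where
  toLinearMap : M.carrier →ₗ[R] N.carrier
  map_act : ∀ a m, toLinearMap (M.act (op a) m) = N.act (op a) (toLinearMap m)
  map_coact : ∀ m, N.coact (toLinearMap m) = toLinearMap.rTensor C (M.coact m)

/-- The category `M_A^C(ψ)`. -/
instance : Category (EntwinedModule ψ) where
  Hom := EntwinedModule.Hom
  id M := ⟨LinearMap.id, fun _ _ => rfl, fun m => by simp⟩
  comp f g := ⟨g.toLinearMap ∘ₗ f.toLinearMap, fun a m => by simp [f.map_act, g.map_act],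
    fun m => by simp [f.map_coact, g.map_coact, LinearMap.rTensor_comp]⟩

theorem alpha_entwine {A' : Type u} [Semiring A'] [Algebra R A'] (κ : MeasuringPairing R A' C)
    {M : Type u} [AddCommMonoid M] [Module R M] (act : Aᵐᵒᵖ →ₐ[R] Module.End R M)
    (a : A) (m : M) (c : C) (g : A') :
    alpha κ M (entwine ψ act a (m ⊗ₜ[R] c)) g = act (op (alpha κ A (ψ (c ⊗ₜ[R] a)) g)) m := by
  simp only [entwine, LinearMap.comp_apply, LinearMap.lTensor_tmul, slice_apply,
    LinearEquiv.coe_coe]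
  generalize ψ (c ⊗ₜ[R] a) = w
  induction w with
  | zero => simp
  | tmul x y => simp
  | add x y hx hy => simp only [tmul_add, map_add, LinearMap.add_apply, hx, hy, MulOpposite.op_add]

/-- The left `A'`-module structure `g m = ∑ m₀ ⟨g, m₁⟩` that a `C`-comodule carries for a measuring
pairing `(A', C)`. -/
def EntwinedModule.leftAct {A' : Type u} [Semiring A'] [Algebra R A'] (M : EntwinedModule ψ)
    (κ : MeasuringPairing R A' C) : A' →ₐ[R] Module.End R M.carrier :=
  AlgHom.ofLinearMap ((alpha κ M.carrier ∘ₗ M.coact).flip)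
    (by ext m; simp [alpha_one, M.counit])
    (fun a b => by
      ext m
      simp only [LinearMap.flip_apply, LinearMap.comp_apply, Module.End.mul_apply]
      rw [alpha_mul, ← M.coassoc, LinearEquiv.symm_apply_apply, alpha_natural])

theorem EntwinedModule.leftAct_apply {A' : Type u} [Semiring A'] [Algebra R A']
    (M : EntwinedModule ψ) (κ : MeasuringPairing R A' C) (g : A') (m : M.carrier) :
    M.leftAct κ g m = alpha κ M.carrier (M.coact m) g := rfl

end EntwiningStructures

section DualModules

variable {R : Type u} [CommRing R]

/-- The left `A`-module structure `(a h)(m) = h(m a)` on the dual of a right `A`-module. -/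
def dualLeft {A M : Type u} [Semiring A] [Algebra R A] [AddCommMonoid M] [Module R M]
    (act : Aᵐᵒᵖ →ₐ[R] Module.End R M) : A →ₐ[R] Module.End R (Module.Dual R M) :=
  AlgHom.ofLinearMap
    (Module.Dual.transpose ∘ₗ act.toLinearMap ∘ₗ (opLinearEquiv R).toLinearMap)
    (by ext; simp [Module.Dual.transpose_apply])
    (fun a b => by ext; simp [Module.Dual.transpose_apply])

@[simp]
theorem dualLeft_apply {A M : Type u} [Semiring A] [Algebra R A] [AddCommMonoid M] [Module R M]
    (act : Aᵐᵒᵖ →ₐ[R] Module.End R M) (a : A) (h : Module.Dual R M) (m : M) :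
    dualLeft act a h m = h (act (op a) m) := rfl

/-- The right `A`-module structure `(h a)(m) = h(a m)` on the dual of a left `A`-module. -/
def dualRight {A M : Type u} [Semiring A] [Algebra R A] [AddCommMonoid M] [Module R M]
    (act : A →ₐ[R] Module.End R M) : Aᵐᵒᵖ →ₐ[R] Module.End R (Module.Dual R M) :=
  AlgHom.ofLinearMap
    (Module.Dual.transpose ∘ₗ act.toLinearMap ∘ₗ (opLinearEquiv R).symm.toLinearMap)
    (by ext; simp [Module.Dual.transpose_apply])
    (fun a b => by ext; simp [Module.Dual.transpose_apply])

@[simp]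
theorem dualRight_apply {A M : Type u} [Semiring A] [Algebra R A] [AddCommMonoid M] [Module R M]
    (act : A →ₐ[R] Module.End R M) (a : A) (h : Module.Dual R M) (m : M) :
    dualRight act (op a) h m = h (act a m) := rfl

variable {A C A' C' : Type u} [Semiring A] [Algebra R A] [AddCommMonoid C] [Module R C] [Coalgebra R C]
  [Semiring A'] [Algebra R A'] [AddCommMonoid C'] [Module R C'] [Coalgebra R C']

/-- `ψ` and `φ` are adjoint for measuring pairings `(A, C')` and `(A', C)`:
`∑ ⟨a_ψ, d⟩ ⟨g, c^ψ⟩ = ∑ ⟨g_φ, c⟩ ⟨a, d^φ⟩`. -/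
def AreDual (κ : MeasuringPairing R A C') (κ' : MeasuringPairing R A' C)
    (ψ : C ⊗[R] A →ₗ[R] A ⊗[R] C) (φ : C' ⊗[R] A' →ₗ[R] A' ⊗[R] C') : Prop :=
  ∀ (c : C) (a : A) (d : C') (g : A'),
    form κ (alpha κ' A (ψ (c ⊗ₜ[R] a)) g) d = form κ' (alpha κ A' (φ (d ⊗ₜ[R] g)) a) c

variable {κ : MeasuringPairing R A C'} {κ' : MeasuringPairing R A' C}
  {ψ : C ⊗[R] A →ₗ[R] A ⊗[R] C} {φ : C' ⊗[R] A' →ₗ[R] A' ⊗[R] C'}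

theorem AreDual.symm (h : AreDual κ κ' ψ φ) : AreDual κ' κ φ ψ :=
  fun c a d g => (h d g c a).symm

variable (M : EntwinedModule ψ)

theorem AreDual.entwine_eq (h : AreDual κ κ' ψ φ) (x : Module.Dual R M.carrier)
    (t : Module.Dual R M.carrier ⊗[R] C')
    (ht : ∀ a, alpha κ _ t a = dualLeft M.act a x) (g : A') (a : A) :
    alpha κ _ (entwine φ (dualRight (M.leftAct κ')) g t) a =
      dualLeft M.act a (dualRight (M.leftAct κ') (op g) x) := by
  ext m
  simp only [dualLeft_apply, dualRight_apply, EntwinedModule.leftAct_apply, M.coact_act]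
  obtain ⟨S, rfl⟩ := TensorProduct.exists_finset t
  have hL : alpha κ _ (entwine φ (dualRight (M.leftAct κ')) g (∑ i ∈ S, i.1 ⊗ₜ[R] i.2)) a m =
      ∑ i ∈ S, i.1 (alpha κ' _ (M.coact m) (alpha κ A' (φ (i.2 ⊗ₜ[R] g)) a)) := by
    simp only [map_sum, LinearMap.sum_apply, alpha_entwine, dualRight_apply,
      EntwinedModule.leftAct_apply]
  rw [hL]
  generalize M.coact m = u
  induction u with
  | zero => simp
  | add u v hu hv => simp only [map_add, LinearMap.add_apply, Finset.sum_add_distrib, hu, hv]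
  | tmul m c =>
    rw [alpha_entwine]
    have := LinearMap.congr_fun (ht (alpha κ' A (ψ (c ⊗ₜ[R] a)) g)) m
    rw [dualLeft_apply] at this
    rw [← this]
    simp [h c a]

/-- The rational part `Rat^{C'}(_A M*)` of the dual of an entwined module. -/
abbrev EntwinedModule.ratDual (κ : MeasuringPairing R A C') :
    Submodule R (Module.Dual R M.carrier) :=
  rat κ (dualLeft M.act)

theorem AreDual.act_mem (h : AreDual κ κ' ψ φ) (g : A') {x : Module.Dual R M.carrier}
    (hx : x ∈ M.ratDual κ) : dualRight (M.leftAct κ') (op g) x ∈ M.ratDual κ := by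
  obtain ⟨t, ht⟩ := mem_rat.1 hx
  exact mem_rat.2 ⟨_, h.entwine_eq M x t ht g⟩

/-- The right `A'`-module structure of `Rat^{C'}(_A M*)`, restricted from `M*`. -/
def ratDualAct (h : AreDual κ κ' ψ φ) : A'ᵐᵒᵖ →ₐ[R] Module.End R (M.ratDual κ) :=
  AlgHom.ofLinearMap
    (LinearMap.mk₂ R (fun g x => ⟨dualRight (M.leftAct κ') g x, h.act_mem M (unop g) x.2⟩)
      (fun _ _ _ => by ext1; simp) (fun _ _ _ => by ext1; simp)
      (fun _ _ _ => by ext1; simp) (fun _ _ _ => by ext1; simp))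
    (by ext1 x; ext1; simp) (fun a b => by ext1 x; ext1; simp)

@[simp]
theorem coe_ratDualAct (h : AreDual κ κ' ψ φ) (g : A'ᵐᵒᵖ) (x : M.ratDual κ) :
    (ratDualAct M h g x : Module.Dual R M.carrier) = dualRight (M.leftAct κ') g x := rfl

theorem coe_alpha_entwine (h : AreDual κ κ' ψ φ) (s : M.ratDual κ ⊗[R] C') (g : A') (a : A) :
    (alpha κ (M.ratDual κ) (entwine φ (M := M.ratDual κ) (ratDualAct M h) g s) a : Module.Dual R M.carrier) =
      alpha κ _ (entwine φ (dualRight (M.leftAct κ')) g ((M.ratDual κ).subtype.rTensor C' s)) a := by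
  induction s with
  | zero => simp only [map_zero, LinearMap.zero_apply, Submodule.coe_zero]
  | add s t hs ht => simp only [map_add, LinearMap.add_apply, Submodule.coe_add, hs, ht]
  | tmul y d => rw [LinearMap.rTensor_tmul, alpha_entwine, alpha_entwine, coe_ratDualAct]; rfl

theorem ratCoact_ratDualAct (hκ : AlphaCondition κ) (h : AreDual κ κ' ψ φ) (x : M.ratDual κ)
    (g : A') : ratCoact hκ (dualLeft M.act) (ratDualAct M h (op g) x) =
      entwine φ (M := M.ratDual κ) (ratDualAct M h) g (ratCoact hκ (dualLeft M.act) x) := by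
  refine hκ (M.ratDual κ) ?_
  refine LinearMap.ext fun a => Subtype.ext ?_
  rw [coe_alpha_entwine, h.entwine_eq M x _ (fun a => ?_) g a, alpha_ratCoact, coe_ratRho,
    coe_ratDualAct]
  rw [alpha_natural, alpha_ratCoact]
  rfl

/-- The dual entwined module `Rat^{C'}(_A M*)` over `(A', C', φ)`. -/
def dualEntwined (hκ : AlphaCondition κ) (h : AreDual κ κ' ψ φ) : EntwinedModule φ where
  carrier := M.ratDual κ
  act := ratDualAct M h
  coact := ratCoact hκ (dualLeft M.act)
  coassoc := ratCoact_coassoc hκ (dualLeft M.act)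
  counit := ratCoact_counit hκ (dualLeft M.act)
  coact_act x g := ratCoact_ratDualAct M hκ h x g

variable {M} {N : EntwinedModule ψ}

theorem dual_mem_rat (f : M ⟶ N) {x : Module.Dual R N.carrier} (hx : x ∈ N.ratDual κ) :
    x ∘ₗ f.toLinearMap ∈ M.ratDual κ := by
  obtain ⟨t, ht⟩ := mem_rat.1 hx
  refine mem_rat.2 ⟨(Module.Dual.transpose (R := R) f.toLinearMap).rTensor C' t, fun a => ?_⟩
  rw [alpha_natural, ht]
  ext m
  simp [Module.Dual.transpose_apply, f.map_act]

/-- The restriction of `f*` to the rational parts. -/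
def ratDualMap (κ : MeasuringPairing R A C') (f : M ⟶ N) : N.ratDual κ →ₗ[R] M.ratDual κ :=
  (Module.Dual.transpose (R := R) f.toLinearMap).restrict fun _ hx => dual_mem_rat f hx

@[simp]
theorem coe_ratDualMap (f : M ⟶ N) (x : N.ratDual κ) :
    (ratDualMap κ f x : Module.Dual R M.carrier) = (x : Module.Dual R N.carrier) ∘ₗ f.toLinearMap :=
  rfl

theorem ratDualMap_act (h : AreDual κ κ' ψ φ) (f : M ⟶ N) (g : A') (x : N.ratDual κ) :
    ratDualMap κ f (ratDualAct N h (op g) x) = ratDualAct M h (op g) (ratDualMap κ f x) := by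
  refine Subtype.ext (LinearMap.ext fun m => ?_)
  simp [EntwinedModule.leftAct_apply, f.map_coact, alpha_natural]

theorem ratDualMap_coact (hκ : AlphaCondition κ) (f : M ⟶ N) (x : N.ratDual κ) :
    ratCoact hκ (dualLeft M.act) (ratDualMap κ f x) =
      (ratDualMap κ f).rTensor C' (ratCoact hκ (dualLeft N.act) x) := by
  refine hκ (M.ratDual κ) ?_
  refine LinearMap.ext fun a => Subtype.ext (LinearMap.ext fun m => ?_)
  rw [alpha_natural, alpha_ratCoact, alpha_ratCoact]
  simp [f.map_act]

/-- The contravariant functor `M ↦ Rat^{C'}(_A M*)`, `f ↦ f*`. -/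
def dualFunctor (hκ : AlphaCondition κ) (h : AreDual κ κ' ψ φ) :
    (EntwinedModule ψ)ᵒᵖ ⥤ EntwinedModule φ where
  obj M := dualEntwined M.unop hκ h
  map f :=
    { toLinearMap := ratDualMap κ f.unop
      map_act := ratDualMap_act h f.unop
      map_coact := ratDualMap_coact hκ f.unop }
  map_id _ := rfl
  map_comp _ _ := rfl

end DualModules

section FiniteDual

/-- An `R`-linear map `K → M` (in practice an inclusion) is pure, in the sense of Cohn, if
`K ⊗ N → M ⊗ N` is injective for every `R`-module `N`. -/
def IsPure {R K M : Type u} [CommRing R] [AddCommMonoid K] [Module R K] [AddCommMonoid M]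
    [Module R M] (f : K →ₗ[R] M) : Prop :=
  ∀ (N : Type u) [AddCommMonoid N] [Module R N], Function.Injective (f.rTensor N)

theorem eq_zero_of_proj_eq_zero {R X M : Type u} [CommRing R] [IsNoetherianRing R]
    [AddCommMonoid M] [Module R M] (t : M ⊗[R] (X → R))
    (h : ∀ a, TensorProduct.rid R M ((LinearMap.proj a : (X → R) →ₗ[R] R).lTensor M t) = 0) :
    t = 0 := by
  obtain ⟨S, rfl⟩ := TensorProduct.exists_finset t
  let π : (S → R) →ₗ[R] M := Fintype.linearCombination R fun i : S => i.1.1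
  obtain ⟨n, k, hk⟩ := Submodule.fg_iff_exists_fin_generating_family.1
    (IsNoetherian.noetherian (LinearMap.ker π))
  have hmem : ∀ a, (fun i : S => i.1.2 a) ∈ Submodule.span R (Set.range k) := by
    intro a
    rw [hk, LinearMap.mem_ker, Fintype.linearCombination_apply, ← h a]
    simp only [map_sum, LinearMap.lTensor_tmul, TensorProduct.rid_tmul, LinearMap.proj_apply]
    exact Finset.sum_coe_sort S fun i => i.2 a • i.1
  choose g hg using fun a => (Submodule.mem_span_range_iff_exists_fun R).1 (hmem a)
  have hk0 : ∀ j, ∑ i : S, k j i • i.1.1 = 0 := fun j => by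
    have : k j ∈ LinearMap.ker π := hk ▸ Submodule.subset_span ⟨j, rfl⟩
    simpa [π, Fintype.linearCombination_apply] using this
  have hf : ∀ i : S, i.1.2 = ∑ j, k j i • fun a => g a j := by
    intro i
    ext a
    have := congrFun (hg a) i
    simp only [Finset.sum_apply, Pi.smul_apply, smul_eq_mul] at this ⊢
    rw [← this]
    exact Finset.sum_congr rfl fun _ _ => mul_comm _ _
  rw [← Finset.sum_coe_sort S fun i => i.1 ⊗ₜ[R] i.2]
  calc ∑ i : S, i.1.1 ⊗ₜ[R] i.1.2
      = ∑ i : S, ∑ j, (k j i • i.1.1) ⊗ₜ[R] (fun a => g a j) := by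
        refine Finset.sum_congr rfl fun i _ => ?_
        conv_lhs => rw [hf i]
        simp [tmul_sum, smul_tmul]
    _ = ∑ j, (∑ i : S, k j i • i.1.1) ⊗ₜ[R] (fun a => g a j) := by
        rw [Finset.sum_comm]
        simp [sum_tmul]
    _ = 0 := Finset.sum_eq_zero fun j _ => by rw [hk0, zero_tmul]

variable (R A : Type u) [CommRing R] [IsNoetherianRing R] [Ring A] [Algebra R A]

variable {A} in
/-- The `R`-module `AfA ⊆ A*`, spanned by the functionals `a f b : x ↦ f(b x a)`. -/
def orbitSpan (f : Module.Dual R A) : Submodule R (Module.Dual R A) :=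
  Submodule.span R (Set.range fun p : A × A => f ∘ₗ LinearMap.mulLeftRight R p)

/-- The finite dual `A° = {f ∈ A* | AfA is finitely generated over R}`. -/
def finiteDual : Submodule R (Module.Dual R A) where
  carrier := {f | (orbitSpan R f).FG}
  zero_mem' := by
    have : orbitSpan R (0 : Module.Dual R A) = ⊥ := by
      rw [orbitSpan, Submodule.span_eq_bot]
      rintro _ ⟨p, rfl⟩
      simp
    change (orbitSpan R (0 : Module.Dual R A)).FG
    rw [this]
    exact Submodule.fg_bot
  add_mem' {f g} hf hg := by
    refine Submodule.FG.of_le (hf.sup hg) (Submodule.span_le.2 ?_)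
    rintro _ ⟨p, rfl⟩
    beta_reduce
    rw [LinearMap.add_comp]
    exact Submodule.add_mem_sup (Submodule.subset_span (Set.mem_range_self p))
      (Submodule.subset_span (Set.mem_range_self p))
  smul_mem' r f hf := by
    refine Submodule.FG.of_le hf (Submodule.span_le.2 ?_)
    rintro _ ⟨p, rfl⟩
    exact Submodule.smul_mem _ r (Submodule.subset_span (Set.mem_range_self p))

/-- `A` is an `α`-algebra: `A° ⊆ R^A` is a pure `R`-submodule. -/
class IsAlphaAlgebra : Prop where
  pure : IsPure (LinearMap.ltoFun R A R R ∘ₗ (finiteDual R A).subtype)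

/-- An `R`-subcoalgebra of `A°`: a pure `R`-submodule `D ⊆ A°` with `Δ(D) ⊆ D ⊗ D`. The
comultiplication of `A°` is dual to the multiplication of `A`: under `A° ⊗ A° ⊆ (A ⊗ A)*`
the element `Δ(f)` is the functional `a ⊗ b ↦ f(ab)`. -/
structure FiniteDualSubcoalgebra extends Submodule R (Module.Dual R A) where
  le_finiteDual : toSubmodule ≤ finiteDual R A
  pure : IsPure (Submodule.inclusion le_finiteDual)
  exists_comul : ∀ f ∈ toSubmodule, ∃ t : toSubmodule ⊗[R] toSubmodule,
    TensorProduct.dualDistrib R A A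
      (TensorProduct.map toSubmodule.subtype toSubmodule.subtype t) = f ∘ₗ LinearMap.mul' R A

variable {R A}

namespace FiniteDualSubcoalgebra

variable (D : FiniteDualSubcoalgebra R A)

/-- Evaluation `f ↦ f(a)` on `D`. -/
def eval : A →ₗ[R] D.toSubmodule →ₗ[R] R :=
  (LinearMap.id : Module.Dual R A →ₗ[R] Module.Dual R A).domRestrict D.toSubmodule |>.flip

@[simp]
theorem eval_apply (a : A) (f : D.toSubmodule) : D.eval a f = (f : Module.Dual R A) a := rfl

/-- The map `m ⊗ f ↦ f(a) m`. -/
def contract (M : Type u) [AddCommMonoid M] [Module R M] (a : A) :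
    M ⊗[R] D.toSubmodule →ₗ[R] M :=
  (TensorProduct.rid R M).toLinearMap ∘ₗ (D.eval a).lTensor M

@[simp]
theorem contract_tmul {M : Type u} [AddCommMonoid M] [Module R M] (a : A) (m : M)
    (f : D.toSubmodule) : D.contract M a (m ⊗ₜ[R] f) = (f : Module.Dual R A) a • m := by
  simp [contract]

theorem contract_natural {M N : Type u} [AddCommMonoid M] [Module R M] [AddCommMonoid N]
    [Module R N] (f : M →ₗ[R] N) (t : M ⊗[R] D.toSubmodule) (a : A) :
    D.contract N a (f.rTensor _ t) = f (D.contract M a t) := by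
  induction t with
  | zero => simp
  | tmul m c => simp
  | add x y hx hy => simp [hx, hy]

theorem ext_contract [IsAlphaAlgebra R A] {M : Type u} [AddCommMonoid M] [Module R M]
    {s t : M ⊗[R] D.toSubmodule} (h : ∀ a, D.contract M a s = D.contract M a t) : s = t := by
  let _ : AddCommGroup M := Module.addCommMonoidToAddCommGroup R
  let ι : D.toSubmodule →ₗ[R] (A → R) := LinearMap.ltoFun R A R R ∘ₗ D.toSubmodule.subtype
  have hι : Function.Injective (ι.lTensor M) := by
    have h1 : ι = (LinearMap.ltoFun R A R R ∘ₗ (finiteDual R A).subtype) ∘ₗ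
        Submodule.inclusion D.le_finiteDual := rfl
    have h2 : Function.Injective (ι.rTensor M) := by
      rw [h1, LinearMap.rTensor_comp]
      exact (IsAlphaAlgebra.pure M).comp (D.pure M)
    have h3 : ι.lTensor M = (TensorProduct.comm R _ _).toLinearMap ∘ₗ ι.rTensor M ∘ₗ
        (TensorProduct.comm R _ _).toLinearMap := by ext; simp
    rw [h3]
    exact (TensorProduct.comm R _ _).injective.comp
      (h2.comp (TensorProduct.comm R _ _).injective)
  have hι' : ∀ (a : A) (w : M ⊗[R] D.toSubmodule),
      TensorProduct.rid R M ((LinearMap.proj a : (A → R) →ₗ[R] R).lTensor M (ι.lTensor M w)) =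
        D.contract M a w := by
    intro a w
    rw [← LinearMap.comp_apply, ← LinearMap.lTensor_comp]
    rfl
  apply hι
  rw [← sub_eq_zero, ← map_sub]
  refine eq_zero_of_proj_eq_zero _ fun a => ?_
  rw [hι', map_sub, h, sub_self]

/-- The canonical map `D ⊗ D → (A ⊗ A)*`. -/
def distrib : D.toSubmodule ⊗[R] D.toSubmodule →ₗ[R] Module.Dual R (A ⊗[R] A) :=
  TensorProduct.dualDistrib R A A ∘ₗ TensorProduct.map D.toSubmodule.subtype D.toSubmodule.subtype

theorem distrib_apply (t : D.toSubmodule ⊗[R] D.toSubmodule) (a b : A) :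
    D.distrib t (a ⊗ₜ[R] b) = (D.contract D.toSubmodule b t : Module.Dual R A) a := by
  induction t with
  | zero => simp
  | tmul m c => simp [distrib, mul_comm]
  | add x y hx hy => simp [hx, hy]

theorem distrib_injective [IsAlphaAlgebra R A] : Function.Injective D.distrib := by
  intro s t h
  refine D.ext_contract fun b => Subtype.ext (LinearMap.ext fun a => ?_)
  rw [← distrib_apply, h, distrib_apply]

/-- The comultiplication of `D`, with `Δ(f)` the unique element of `D ⊗ D` that represents
`a ⊗ b ↦ f(ab)`. -/
def comul [IsAlphaAlgebra R A] : D.toSubmodule →ₗ[R] D.toSubmodule ⊗[R] D.toSubmodule :=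
  (LinearEquiv.ofInjective D.distrib D.distrib_injective).symm.toLinearMap ∘ₗ
    ((LinearMap.lcomp R R (LinearMap.mul' R A)) ∘ₗ D.toSubmodule.subtype).codRestrict _
      fun f => D.exists_comul f f.2

theorem distrib_comul [IsAlphaAlgebra R A] (f : D.toSubmodule) :
    D.distrib (D.comul f) = (f : Module.Dual R A) ∘ₗ LinearMap.mul' R A :=
  congrArg Subtype.val ((LinearEquiv.ofInjective D.distrib D.distrib_injective).apply_symm_apply _)

theorem contract_comul [IsAlphaAlgebra R A] (f : D.toSubmodule) (a b : A) :
    (D.contract D.toSubmodule b (D.comul f) : Module.Dual R A) a = (f : Module.Dual R A) (a * b) := by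
  rw [← distrib_apply, distrib_comul]
  simp

theorem contract_lTensor_comul [IsAlphaAlgebra R A] {M : Type u} [AddCommMonoid M] [Module R M]
    (t : M ⊗[R] D.toSubmodule) (b c : A) :
    D.contract M b (D.contract (M ⊗[R] D.toSubmodule) c
      ((TensorProduct.assoc R M _ _).symm (D.comul.lTensor M t))) = D.contract M (b * c) t := by
  induction t with
  | zero => simp
  | add x y hx hy => simp [hx, hy]
  | tmul m f =>
    rw [LinearMap.lTensor_tmul, contract_tmul, ← contract_comul]
    generalize D.comul f = w
    induction w with
    | zero => simp
    | add x y hx hy => simp [tmul_add, add_smul, hx, hy]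
    | tmul x y => simp [smul_smul]

/-- The coalgebra structure of a subcoalgebra of `A°`; the counit is `f ↦ f(1)`. -/
instance [IsAlphaAlgebra R A] : Coalgebra R D.toSubmodule where
  comul := D.comul
  counit := D.eval 1
  coassoc := by
    refine LinearMap.ext fun f => (TensorProduct.assoc R _ _ _).symm.injective ?_
    refine D.ext_contract fun c => D.ext_contract fun b => Subtype.ext (LinearMap.ext fun a => ?_)
    simp only [LinearMap.comp_apply, LinearEquiv.coe_coe, LinearEquiv.symm_apply_apply]
    rw [contract_lTensor_comul, contract_natural, contract_comul, contract_comul, contract_comul,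
      mul_assoc]
  rTensor_counit_comp_comul := by
    refine LinearMap.ext fun f => D.ext_contract fun b => ?_
    rw [LinearMap.comp_apply, contract_natural, eval_apply, contract_comul]
    simp
  lTensor_counit_comp_comul := by
    refine LinearMap.ext fun f => (TensorProduct.rid R _).injective ?_
    refine Subtype.ext (LinearMap.ext fun a => ?_)
    have := D.contract_comul f a 1
    rw [mul_one] at this
    simpa [contract] using this

/-- The measuring pairing `(A, D)`, `⟨a, f⟩ = f(a)`. -/
def pairing [IsAlphaAlgebra R A] : MeasuringPairing R A D.toSubmodule :=
  AlgHom.ofLinearMap ((WithConv.linearEquiv R _).symm.toLinearMap ∘ₗ D.eval)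
    (by ext f; simp; rfl)
    (fun a b => by
      ext f
      have h := D.contract_comul f a b
      rw [← distrib_apply] at h
      simp only [LinearMap.convMul_apply]
      refine h.symm.trans ?_
      change D.distrib (D.comul f) (a ⊗ₜ[R] b) =
        LinearMap.mul' R R (TensorProduct.map (D.eval a) (D.eval b) (D.comul f))
      generalize D.comul f = w
      induction w with
      | zero => simp
      | add x y hx hy => simp [hx, hy]
      | tmul x y => simp [distrib])

theorem form_pairing [IsAlphaAlgebra R A] (a : A) (f : D.toSubmodule) :
    form D.pairing a f = (f : Module.Dual R A) a := rfl

theorem alphaCondition [IsAlphaAlgebra R A] : AlphaCondition D.pairing := by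
  intro M _ _ s t h
  have key : ∀ (w : M ⊗[R] D.toSubmodule) (a : A), alpha D.pairing M w a = D.contract M a w := by
    intro w a
    induction w with
    | zero => simp
    | add x y hx hy => simp [hx, hy]
    | tmul x y => simp [form_pairing]
  exact D.ext_contract fun a => by rw [← key, ← key, h]

end FiniteDualSubcoalgebra

end FiniteDual

section DualEntwining

variable {R A C : Type u} [CommRing R] [IsNoetherianRing R] [Ring A] [Algebra R A]
  [IsAlphaAlgebra R A] [AddCommGroup C] [Module R C] [Coalgebra R C]

/-- For a subalgebra `B ⊆ C*` and a subcoalgebra `D ⊆ A°`, the map `φ : D ⊗ B → B ⊗ D` is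
the restriction of `ψ* : (A ⊗ C)* → (C ⊗ A)*` along the canonical maps `D ⊗ B → (A ⊗ C)*` and
`B ⊗ D → (C ⊗ A)*`. -/
def IsDualMap (ψ : C ⊗[R] A →ₗ[R] A ⊗[R] C) (B : Subalgebra R (WithConv (C →ₗ[R] R)))
    (D : FiniteDualSubcoalgebra R A)
    (φ : D.toSubmodule ⊗[R] B →ₗ[R] B ⊗[R] D.toSubmodule) : Prop :=
  ∀ t : D.toSubmodule ⊗[R] B,
    TensorProduct.dualDistrib R C A
      (TensorProduct.map (form B.val) D.toSubmodule.subtype (φ t)) =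
    TensorProduct.dualDistrib R A C
      (TensorProduct.map D.toSubmodule.subtype (form B.val) t) ∘ₗ ψ

variable {ψ : C ⊗[R] A →ₗ[R] A ⊗[R] C} {B : Subalgebra R (WithConv (C →ₗ[R] R))}
  {D : FiniteDualSubcoalgebra R A} {φ : D.toSubmodule ⊗[R] B →ₗ[R] B ⊗[R] D.toSubmodule}

theorem IsDualMap.areDual (h : IsDualMap ψ B D φ) : AreDual D.pairing B.val ψ φ := by
  intro c a d g
  have h1 := LinearMap.congr_fun (h (d ⊗ₜ[R] g)) (c ⊗ₜ[R] a)
  have hL : ∀ w : B ⊗[R] D.toSubmodule, TensorProduct.dualDistrib R C A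
      (TensorProduct.map (form B.val) D.toSubmodule.subtype w) (c ⊗ₜ[R] a) =
        form B.val (alpha D.pairing B w a) c := by
    intro w
    induction w with
    | zero => simp
    | add x y hx hy => simp only [map_add, LinearMap.add_apply, hx, hy]
    | tmul x y => simp [FiniteDualSubcoalgebra.form_pairing, mul_comm]
  have hR : ∀ w : A ⊗[R] C, TensorProduct.dualDistrib R A C
      (TensorProduct.map D.toSubmodule.subtype (form B.val) (d ⊗ₜ[R] g)) w =
        form D.pairing (alpha B.val A w g) d := by
    intro w
    induction w with
    | zero => simp
    | add x y hx hy => simp only [map_add, LinearMap.add_apply, hx, hy]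
    | tmul x y => simp [FiniteDualSubcoalgebra.form_pairing, mul_comm]
  rw [hL, LinearMap.comp_apply, hR] at h1
  exact h1.symm

/-- The contravariant functor `M ↦ M_r = Rat^D(_A M*)` from `M_A^C(ψ)` to `M_B^D(φ)`. -/
def lowerR (h : IsDualMap ψ B D φ) : (EntwinedModule ψ)ᵒᵖ ⥤ EntwinedModule φ :=
  dualFunctor D.alphaCondition h.areDual

/-- The contravariant functor `K ↦ K^r = Rat^C(_B K*)` from `M_B^D(φ)` to `M_A^C(ψ)`. -/
def upperR (h : IsDualMap ψ B D φ) (hα : AlphaCondition B.val) :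
    (EntwinedModule φ)ᵒᵖ ⥤ EntwinedModule ψ :=
  dualFunctor hα h.areDual.symm

end DualEntwining

end Entwined

end

namespace Entwined

/-! ### Entwining structures dual to each other -/

section DualEntwiningStructure

variable {R : Type u} [CommRing R]
variable {A C A' C' : Type u} [Semiring A] [Algebra R A] [AddCommMonoid C] [Module R C]
  [Coalgebra R C] [Semiring A'] [Algebra R A'] [AddCommMonoid C'] [Module R C'] [Coalgebra R C']
variable {κ : MeasuringPairing R A C'} {κ' : MeasuringPairing R A' C}
  {ψ : C ⊗[R] A →ₗ[R] A ⊗[R] C} {φ : C' ⊗[R] A' →ₗ[R] A' ⊗[R] C'}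

/-! Both claims rest on the duality `∑ ⟨a_ψ, d⟩ ⟨g, c^ψ⟩ = ∑ ⟨g_φ, c⟩ ⟨a, d^φ⟩`, which is symmetric
under exchanging the two sides.

For the entwining axioms: an element of `A' ⊗ C'` is determined by its contractions with all `a ∈ A`
and `c ∈ C`, since `(A, C')` satisfies the `α`-condition and `A'` embeds in `C*`. Because products
pair with comultiplications and units with counits, each axiom for `φ`, tested on such elements, is
the opposite axiom for `ψ`: multiplicativity and comultiplicativity are interchanged, as are the
unit and counit conditions. The computation behind this is `AreDual.form_mul_slice`, used once as it
stands and once with the sides exchanged; the conclusion is `AreDual.isEntwining`.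

For the adjunction: a morphism `M ⟶ K^r` yields a bilinear form `β` on `M × K` with `β(ma, k) = β(m,
ak)` and `β(gm, k) = β(m, kg)`, where `ak` and `gm` come from the coactions. These two conditions
treat `M` and `K` alike. Rationality of `β(-, k)` is then automatic: `a β(-, k) = β(-, ak) = ∑ k₁(a)
β(-, k₀)`. Colinearity follows from the first condition, as a coaction on a rational part is
determined by the action. Hence `β` also defines a morphism `K ⟶ M_r` (`flipHom`), and exchanging
arguments twice changes nothing. -/

theorem alpha_mul'_rTensor_slice (κ' : MeasuringPairing R A' C) (ψ : C ⊗[R] A →ₗ[R] A ⊗[R] C)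
    (x : A) (c : C) (b : A) (g : A') :
    alpha κ' A ((LinearMap.mul' R A).rTensor C ((TensorProduct.assoc R A A C).symm
      ((slice ψ b).lTensor A (x ⊗ₜ[R] c)))) g = x * alpha κ' A (ψ (c ⊗ₜ[R] b)) g := by
  rw [LinearMap.lTensor_tmul, slice_apply]
  generalize ψ (c ⊗ₜ[R] b) = w
  induction w with
  | zero => simp
  | add x y hx hy => simp only [tmul_add, map_add, LinearMap.add_apply, mul_add, hx, hy]
  | tmul y e => simp

/-- Contracting the last factor with `g'` commutes with applying `ψ` to the first two, so the two
applications of `ψ` can be evaluated one after the other. -/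
theorem alpha_alpha_rTensor_slice (κ' : MeasuringPairing R A' C)
    (ψ : C ⊗[R] A →ₗ[R] A ⊗[R] C) (a : A) (c₁ c₂ : C) (g g' : A') :
    alpha κ' A (alpha κ' (A ⊗[R] C) (ψ.rTensor C ((TensorProduct.assoc R C A C).symm
      ((slice ψ a).lTensor C (c₁ ⊗ₜ[R] c₂)))) g') g =
        alpha κ' A (ψ (c₁ ⊗ₜ[R] alpha κ' A (ψ (c₂ ⊗ₜ[R] a)) g')) g := by
  rw [LinearMap.lTensor_tmul, slice_apply, alpha_natural]
  generalize ψ (c₂ ⊗ₜ[R] a) = w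
  induction w with
  | zero => simp
  | add x y hx hy => simp only [tmul_add, map_add, LinearMap.add_apply, hx, hy]
  | tmul y e => simp

/-- The product in the first tensor factor on the `ψ` side is dual to the comultiplication on the
`φ` side: `∑ ⟨a_ψ b_Ψ, d⟩ ⟨g, c^{ψΨ}⟩ = ∑ ⟨g_{φΦ}, c⟩ ⟨a, d₁^Φ⟩ ⟨b, d₂^φ⟩`. -/
theorem AreDual.form_mul_slice (h : AreDual κ κ' ψ φ) (c : C) (a b : A) (d : C') (g : A') :
    form κ (alpha κ' A ((LinearMap.mul' R A).rTensor C ((TensorProduct.assoc R A A C).symm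
      ((slice ψ b).lTensor A (ψ (c ⊗ₜ[R] a))))) g) d =
    form κ' (alpha κ A' (alpha κ (A' ⊗[R] C') (φ.rTensor C' ((TensorProduct.assoc R C' A' C').symm
      ((slice φ g).lTensor C' (Coalgebra.comul (R := R) d)))) b) a) c := by
  obtain ⟨S, hS⟩ := TensorProduct.exists_finset (Coalgebra.comul (R := R) d)
  -- The pairing with `d` splits the product along `Δ(d) = ∑ d₁ ⊗ d₂`. Duality for `b` and `d₂` then
  -- replaces `g` by `∑ ⟨b, d₂^φ⟩ g_φ`. Stating this for all `t` allows induction on `t = ψ(c ⊗ a)`.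
  have hL : ∀ t : A ⊗[R] C,
      form κ (alpha κ' A ((LinearMap.mul' R A).rTensor C ((TensorProduct.assoc R A A C).symm
        ((slice ψ b).lTensor A t))) g) d =
      ∑ i ∈ S, form κ (alpha κ' A t (alpha κ A' (φ (i.2 ⊗ₜ[R] g)) b)) i.1 := by
    intro t
    induction t with
    | zero => simp
    | add x y hx hy => simp only [map_add, LinearMap.add_apply, Finset.sum_add_distrib, hx, hy]
    | tmul x c =>
      rw [alpha_mul'_rTensor_slice, form_mul, hS]
      simp [h c b, mul_comm]
  rw [hL, hS]
  -- A second use of duality, now for `a` and `d₁`, produces the outer application of `φ`.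
  simp only [map_sum, LinearMap.sum_apply, alpha_alpha_rTensor_slice, h c a]

/-- Elements of `A' ⊗ C'` are separated by `A` and `C` if the pairing `(A, C')` satisfies the
`α`-condition and `A' → C*` is injective. -/
theorem ext_form_alpha (hκ : AlphaCondition κ) (hκ' : Function.Injective (form κ'))
    {s t : A' ⊗[R] C'}
    (hst : ∀ a c, form κ' (alpha κ A' s a) c = form κ' (alpha κ A' t a) c) : s = t :=
  hκ A' (LinearMap.ext fun a => hκ' (LinearMap.ext fun c => hst a c))

/-- A map dual to an entwining structure is an entwining structure. -/
theorem AreDual.isEntwining (h : AreDual κ κ' ψ φ) (hκ : AlphaCondition κ)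
    (hκ' : Function.Injective (form κ')) (hψ : IsEntwining ψ) : IsEntwining φ where
  map_mul d g g' := by
    -- Tested on `a` and `c`, this is comultiplicativity of `ψ` at `c ⊗ a`, contracted with `g`,
    -- `g'` and `d`.
    refine ext_form_alpha hκ hκ' fun a c => ?_
    rw [h.symm.form_mul_slice, ← h, alpha_mul, hψ.map_comul, LinearEquiv.symm_apply_apply]
  map_one d := by
    refine ext_form_alpha hκ hκ' fun a c => ?_
    rw [← h, alpha_one, hψ.map_counit]
    simp [form_one, mul_comm]
  map_comul d g := by
    -- With the brackets moved to `(A' ⊗ C') ⊗ C'`, the `α`-condition with coefficients in `A' ⊗ C'`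
    -- removes the last factor by means of `b`. What remains is multiplicativity of `ψ` for the
    -- product `a * b`.
    refine (TensorProduct.assoc R _ _ _).symm.injective (hκ _ (LinearMap.ext fun b =>
      ext_form_alpha hκ hκ' fun a c => ?_))
    rw [LinearEquiv.symm_apply_apply, ← alpha_mul, ← h, hψ.map_mul, h.form_mul_slice]
  map_counit d g := by
    -- The identity lies in `A'`, so `c` alone tests it; the counit of `C'` is contraction with `1 ∈
    -- A`.
    refine hκ' (LinearMap.ext fun c => ?_)
    rw [← alpha_one κ, ← h, hψ.map_one]
    simp [form_one, mul_comm]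

end DualEntwiningStructure

/-! ### Exchanging the arguments of a bilinear form, and the adjunction -/

section Flip

variable {R : Type u} [CommRing R]
variable {A C A' C' : Type u} [Semiring A] [Algebra R A] [AddCommMonoid C] [Module R C]
  [Coalgebra R C] [Semiring A'] [Algebra R A'] [AddCommMonoid C'] [Module R C'] [Coalgebra R C']
variable {κ : MeasuringPairing R A C'} {κ' : MeasuringPairing R A' C}
  {ψ : C ⊗[R] A →ₗ[R] A ⊗[R] C} {φ : C' ⊗[R] A' →ₗ[R] A' ⊗[R] C'}
  {M : EntwinedModule ψ} {K : EntwinedModule φ}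

/-- The bilinear form `(m, k) ↦ f(m)(k)` of a morphism `f : M ⟶ Rat^C(_{A'} K*)`. -/
noncomputable def pairingOfHom (hκ' : AlphaCondition κ') (h : AreDual κ κ' ψ φ)
    (f : M ⟶ dualEntwined K hκ' h.symm) : M.carrier →ₗ[R] Module.Dual R K.carrier :=
  (K.ratDual κ').subtype ∘ₗ f.toLinearMap

theorem pairingOfHom_act (hκ' : AlphaCondition κ') (h : AreDual κ κ' ψ φ)
    (f : M ⟶ dualEntwined K hκ' h.symm) (a : A) (m : M.carrier) (k : K.carrier) :
    pairingOfHom hκ' h f (M.act (op a) m) k = pairingOfHom hκ' h f m (K.leftAct κ a k) := by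
  have := f.map_act a m
  exact LinearMap.congr_fun (congrArg Subtype.val this) k

/-- This is colinearity of `f` contracted with `g`: on a rational part, contracting the coaction
gives back the action from which it was built. -/
theorem pairingOfHom_leftAct (hκ' : AlphaCondition κ') (h : AreDual κ κ' ψ φ)
    (f : M ⟶ dualEntwined K hκ' h.symm) (g : A') (m : M.carrier) (k : K.carrier) :
    pairingOfHom hκ' h f (M.leftAct κ' g m) k = pairingOfHom hκ' h f m (K.act (op g) k) := by
  have h1 := congrArg (fun t => alpha κ' _ t g) (f.map_coact m)
  have h2 := LinearMap.congr_fun (congrArg Subtype.val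
    ((alpha_natural κ' f.toLinearMap (M.coact m) g).symm.trans h1.symm)) k
  refine h2.trans ?_
  have h3 := LinearMap.congr_fun (alpha_ratCoact hκ' (dualLeft K.act) (f.toLinearMap m)) g
  exact LinearMap.congr_fun (congrArg Subtype.val h3) k

/-- Provides the witness for rationality of `β(-, k)`: the image of the coaction of `k` under `β(-,
·) ⊗ C'`. -/
theorem alpha_rTensor_flip (hκ' : AlphaCondition κ') (h : AreDual κ κ' ψ φ)
    (f : M ⟶ dualEntwined K hκ' h.symm) (k : K.carrier) (a : A) :
    alpha κ _ ((pairingOfHom hκ' h f).flip.rTensor C' (K.coact k)) a =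
      dualLeft M.act a ((pairingOfHom hκ' h f).flip k) := by
  rw [alpha_natural]
  ext m
  exact (pairingOfHom_act hκ' h f a m k).symm

/-- The morphism `k ↦ [m ↦ f(m)(k)]` that corresponds to `f : M ⟶ Rat^C(_{A'} K*)`. -/
noncomputable def flipHom (hκ : AlphaCondition κ) (hκ' : AlphaCondition κ') (h : AreDual κ κ' ψ φ)
    (f : M ⟶ dualEntwined K hκ' h.symm) : K ⟶ dualEntwined M hκ h where
  toLinearMap := (pairingOfHom hκ' h f).flip.codRestrict (M.ratDual κ)
    fun k => mem_rat.2 ⟨_, alpha_rTensor_flip hκ' h f k⟩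
  -- Linearity over `A'` comes from the colinearity of `f`.
  map_act g k := Subtype.ext (LinearMap.ext fun m => (pairingOfHom_leftAct hκ' h f g m k).symm)
  map_coact k := by
    -- By the `α`-condition, colinearity may be checked after contraction with each `a`, where it
    -- reduces to the `A`-linearity of `f`.
    refine hκ (M.ratDual κ) (LinearMap.ext fun a => ?_)
    refine (LinearMap.congr_fun (alpha_ratCoact hκ (dualLeft M.act) _) a).trans ?_
    refine Eq.trans ?_ (alpha_natural κ _ (K.coact k) a).symm
    exact Subtype.ext (LinearMap.ext fun m => pairingOfHom_act hκ' h f a m k)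

/-- The bijection `Hom(K, Rat^{C'}(_A M*)) ≃ Hom(M, Rat^C(_{A'} K*))`. -/
noncomputable def flipEquiv (hκ : AlphaCondition κ) (hκ' : AlphaCondition κ') (h : AreDual κ κ' ψ φ) :
    (K ⟶ dualEntwined M hκ h) ≃ (M ⟶ dualEntwined K hκ' h.symm) where
  toFun g := flipHom hκ' hκ h.symm g
  invFun f := flipHom hκ hκ' h f
  -- Exchanging arguments twice restores the underlying map, and the other data of a morphism are
  -- proofs.
  left_inv _ := rfl
  right_inv _ := rfl

/-- The dual functors of adjoint entwining structures are adjoint on the right. -/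
noncomputable def dualAdjunction (hκ : AlphaCondition κ) (hκ' : AlphaCondition κ') (h : AreDual κ κ' ψ φ) :
    (dualFunctor hκ h).rightOp ⊣ dualFunctor hκ' h.symm :=
  Adjunction.mkOfHomEquiv
    { homEquiv := fun M K => (opEquiv _ _).trans (flipEquiv (M := M) (K := K.unop) hκ hκ' h)
      homEquiv_naturality_left_symm := fun _ _ => rfl
      homEquiv_naturality_right := fun _ _ => rfl }

end Flip

end Entwined

theorem mainTheorem2 {R A C : Type u} [CommRing R] [IsNoetherianRing R]
    [Ring A] [Algebra R A] [Entwined.IsAlphaAlgebra R A]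
    [AddCommGroup C] [Module R C] [Coalgebra R C]
    (ψ : C ⊗[R] A →ₗ[R] A ⊗[R] C) (hψ : Entwined.IsEntwining ψ)
    (B : Subalgebra R (WithConv (C →ₗ[R] R))) (D : Entwined.FiniteDualSubcoalgebra R A)
    (φ : D.toSubmodule ⊗[R] B →ₗ[R] B ⊗[R] D.toSubmodule) (hφ : Entwined.IsDualMap ψ B D φ)
    (hα : Entwined.AlphaCondition B.val) :
    Entwined.IsEntwining φ ∧
      ∃ adj : (Entwined.lowerR hφ).rightOp ⊣ Entwined.upperR hφ hα,
        ∀ (M : Entwined.EntwinedModule ψ) (K : Entwined.EntwinedModule φ)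
          (g : K ⟶ (Entwined.lowerR hφ).obj (Opposite.op M)) (m : M.carrier) (k : K.carrier),
          Subtype.val (p := (· ∈ K.ratDual B.val))
              ((adj.homEquiv M (Opposite.op K) g.op).toLinearMap m) k =
            Subtype.val (p := (· ∈ M.ratDual D.pairing)) (g.toLinearMap k) m := by
  -- The general results apply to evaluation `(A, D)` and the inclusion `B ⊆ C*`. For the entwining
  -- axioms it remains to see that an element of `B` is determined by its functional on `C`.
  refine ⟨hφ.areDual.isEntwining D.alphaCondition (fun _ _ hxy => Subtype.ext ?_) hψ,
    Entwined.dualAdjunction D.alphaCondition hα hφ.areDual, fun M K g m k => ?_⟩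
  · exact (WithConv.linearEquiv R (C →ₗ[R] R)).injective hxy
  -- The bijection of the adjunction is the exchange of arguments by construction.
  · rfl
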